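/- Let $\mathcal A$ be a unital (complex) $C^*$-algebra, let $\mathcal I\subseteq\mathcal A$ be a left ideal (not necessarily closed), and let $g_0:\mathcal I\to\mathbb C$ be a linear functional. Then the following two conditions are equivalent. (1) $g_0$ has a continuous hermitian extension to $\mathcal A$: there is a continuous linear functional $g:\mathcal A\to\mathbb C$ with $g(x^*)=\overline{g(x)}$ for all $x\in\mathcal A$ and $g(a)=g_0(a)$ for all $a\in\mathcal I$. (2) $g_0$ is symmetric, that is, $g_0(b^*a)=\overline{g_0(a^*b)}$ for all $a,b\in\mathcal I$, and $g_0$ is $f$-bounded for some positive functional $f$ on $\mathcal A$, that is, there are a linear functional $f:\mathcal A\to\mathbb C$ with $f(x^*x)\ge 0$ for all $x\in\mathcal A$ and a constant $\alpha>0$ such that $$|g_0(x^*a)|^2\le\alpha^2\,f(x^*x)\,f(a^*a)\qquad\text{for all }x\in\mathcal A,\ a\in\mathcal I.$$ -/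

import Mathlib

open scoped ComplexOrder

/-- A linear functional on a complex *-algebra is positive if `f (x* x)` is real and nonnegative
for all `x` (the order on `ℂ` is `0 ≤ z ↔ 0 ≤ re z ∧ im z = 0`). -/
def IsPositiveFunctional {A : Type*} [CStarAlgebra A] (f : A →ₗ[ℂ] ℂ) : Prop :=
  ∀ x : A, 0 ≤ f (star x * x)

/-- A linear functional on a complex *-algebra is hermitian if `g (x*)` is the complex conjugate
of `g x` for all `x`. -/
def IsHermitianFunctional {A : Type*} [CStarAlgebra A] (g : A →ₗ[ℂ] ℂ) : Prop :=
  ∀ x : A, g (star x) = star (g x)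

/-- A linear functional on a left ideal `I` is symmetric if `g (b* a)` is the complex conjugate
of `g (a* b)` for all `a, b ∈ I`. (`Ideal A` is the type of left ideals of `A`.) -/
def IsSymmetricFunctional {A : Type*} [CStarAlgebra A] {I : Ideal A} (g : I →ₗ[ℂ] ℂ) : Prop :=
  ∀ a b : I, g ⟨star (b : A) * a, I.mul_mem_left _ a.2⟩ =
    star (g ⟨star (a : A) * b, I.mul_mem_left _ b.2⟩)

/-- A linear functional `g` on a left ideal `I` is `f`-bounded, for a positive functional `f` on
`A`, if `|g (x* a)|² ≤ α² f (x* x) f (a* a)` for all `x ∈ A` and `a ∈ I`, with some constant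
`α > 0`. The two values of `f` are real since `f` is positive. -/
def IsBoundedByFunctional {A : Type*} [CStarAlgebra A] {I : Ideal A} (f : A →ₗ[ℂ] ℂ)
    (g : I →ₗ[ℂ] ℂ) : Prop :=
  ∃ α : ℝ, 0 < α ∧ ∀ (x : A) (a : I),
    ‖g ⟨star x * (a : A), I.mul_mem_left _ a.2⟩‖ ^ 2 ≤
      α ^ 2 * (f (star x * x)).re * (f (star (a : A) * a)).re

open InnerProductSpace

/-! ### Extension inside a representation -/

section Representation

variable {A : Type*} [CStarAlgebra A] {H : Type*} [NormedAddCommGroup H] [InnerProductSpace ℂ H]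
  [CompleteSpace H]

/-! From `f`-boundedness to an extension: in the GNS representation `π` of `f` with cyclic vector
`u`, `‖π x u‖² = f (x* x)`. Let `M` be the closure of `π(I) u`. Boundedness gives `η ∈ M` with `g₀ a
= ⟪η, π a u⟫` and a bounded `T : π a u ↦ π a η` on `M`, which commutes with `π` and is symmetric
because `g₀` is. With `e` the projection of `u` to `M`, the extension is `⟪η, π x u⟫ + ⟪u, π x η⟫ -
⟪T e, π x e⟫`: the first two terms are hermitian together, the third alone, and on `I` the last two
cancel. Conversely, write a hermitian `g` as `f - h` with `f`, `h` positive; Cauchy–Schwarz for each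
bounds `g` by `f + h`. -/

/-- The functional `x ↦ ⟪u, π x v⟫` of a representation `π` of a C⋆-algebra. -/
noncomputable def vectorFunctional (π : A →⋆ₐ[ℂ] (H →L[ℂ] H)) (u v : H) : A →L[ℂ] ℂ where
  toFun x := inner ℂ u (π x v)
  map_add' x y := by simp
  map_smul' c x := by simp
  cont := by
    have : Continuous π := AddMonoidHomClass.continuous_of_bound π 1 fun x ↦ by
      simpa using NonUnitalStarAlgHom.norm_apply_le π x
    fun_prop

@[simp]
lemma vectorFunctional_apply (π : A →⋆ₐ[ℂ] (H →L[ℂ] H)) (u v : H) (x : A) :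
    vectorFunctional π u v x = inner ℂ u (π x v) := rfl

lemma StarAlgHom.inner_map_star_apply (π : A →⋆ₐ[ℂ] (H →L[ℂ] H)) (x : A) (u v : H) :
    inner ℂ (π (star x) u) v = inner ℂ u (π x v) := by
  rw [map_star, ContinuousLinearMap.star_eq_adjoint, ContinuousLinearMap.adjoint_inner_left]

/-- The map `a ↦ π a u` on a left ideal. -/
noncomputable def idealOrbitMap (π : A →⋆ₐ[ℂ] (H →L[ℂ] H)) (u : H) (I : Ideal A) : I →ₗ[ℂ] H where
  toFun a := π a u
  map_add' a b := by simp
  map_smul' c a := by simp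

@[simp]
lemma idealOrbitMap_apply (π : A →⋆ₐ[ℂ] (H →L[ℂ] H)) (u : H) (I : Ideal A) (a : I) :
    idealOrbitMap π u I a = π a u := rfl

/-- The closure of the subspace `π(I) u`. -/
noncomputable def idealOrbitClosure (π : A →⋆ₐ[ℂ] (H →L[ℂ] H)) (u : H) (I : Ideal A) : Submodule ℂ H :=
  (idealOrbitMap π u I).range.topologicalClosure

instance (π : A →⋆ₐ[ℂ] (H →L[ℂ] H)) (u : H) (I : Ideal A) :
    CompleteSpace (idealOrbitClosure π u I) :=
  Submodule.topologicalClosure.completeSpace _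

/-- The map `a ↦ π a u` from a left ideal to the closure of its range. -/
noncomputable def idealOrbitMapClosure (π : A →⋆ₐ[ℂ] (H →L[ℂ] H)) (u : H) (I : Ideal A) :
    I →ₗ[ℂ] idealOrbitClosure π u I :=
  (idealOrbitMap π u I).codRestrict _ fun a ↦
    Submodule.le_topologicalClosure _ ⟨a, rfl⟩

@[simp]
lemma coe_idealOrbitMapClosure (π : A →⋆ₐ[ℂ] (H →L[ℂ] H)) (u : H) (I : Ideal A) (a : I) :
    (idealOrbitMapClosure π u I a : H) = π a u := rfl

lemma denseRange_idealOrbitMapClosure (π : A →⋆ₐ[ℂ] (H →L[ℂ] H)) (u : H) (I : Ideal A) :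
    DenseRange (idealOrbitMapClosure π u I) := by
  rintro ⟨m, hm⟩
  rw [closure_subtype, ← Set.range_comp]
  exact hm

lemma map_mem_idealOrbitClosure (π : A →⋆ₐ[ℂ] (H →L[ℂ] H)) (u : H) (I : Ideal A) (x : A)
    {m : H} (hm : m ∈ idealOrbitClosure π u I) : π x m ∈ idealOrbitClosure π u I := by
  refine map_mem_closure (π x).continuous hm ?_
  rintro _ ⟨a, rfl⟩
  exact ⟨⟨x * a, I.mul_mem_left _ a.2⟩, by simp⟩

/-- The restriction of a representation to the closure of `π(I) u`. -/
noncomputable def idealOrbitRestrict (π : A →⋆ₐ[ℂ] (H →L[ℂ] H)) (u : H) (I : Ideal A) (x : A) :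
    idealOrbitClosure π u I →L[ℂ] idealOrbitClosure π u I :=
  ((π x).comp (idealOrbitClosure π u I).subtypeL).codRestrict _
    fun m ↦ map_mem_idealOrbitClosure π u I x m.2

@[simp]
lemma coe_idealOrbitRestrict (π : A →⋆ₐ[ℂ] (H →L[ℂ] H)) (u : H) (I : Ideal A) (x : A)
    (m : idealOrbitClosure π u I) : (idealOrbitRestrict π u I x m : H) = π x m := rfl

/-- A bounded functional on `π(I) u` is represented by a vector of its closure. -/
lemma exists_inner_eq_of_le_norm (π : A →⋆ₐ[ℂ] (H →L[ℂ] H)) (u : H) {I : Ideal A}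
    (g₀ : I →ₗ[ℂ] ℂ) {C : ℝ} (hC : ∀ a : I, ‖g₀ a‖ ≤ C * ‖π a u‖) :
    ∃ η : idealOrbitClosure π u I, ∀ a : I, inner ℂ (η : H) (π a u) = g₀ a := by
  let φ := g₀.extendOfNorm (idealOrbitMapClosure π u I)
  refine ⟨(toDual ℂ _).symm φ, fun a ↦ ?_⟩
  have h := toDual_symm_apply (𝕜 := ℂ) (x := idealOrbitMapClosure π u I a) (y := φ)
  rw [Submodule.coe_inner, coe_idealOrbitMapClosure] at h
  rw [h]
  exact LinearMap.extendOfNorm_eq (denseRange_idealOrbitMapClosure π u I) ⟨C, hC⟩ a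

/-- The vector representing a symmetric functional `g₀` with `|g₀ (a* b)| ≤ C ‖π a u‖ ‖π b u‖`
gives a bounded symmetric operator `π a u ↦ π a η` commuting with `π`. -/
lemma exists_isSymmetric_commute (π : A →⋆ₐ[ℂ] (H →L[ℂ] H)) (u : H) {I : Ideal A}
    {g₀ : I →ₗ[ℂ] ℂ} (hs : IsSymmetricFunctional g₀) {C : ℝ}
    (hC : ∀ a b : I, ‖g₀ ⟨star (a : A) * b, I.mul_mem_left _ b.2⟩‖ ≤ C * ‖π a u‖ * ‖π b u‖)
    (η : idealOrbitClosure π u I) (hη : ∀ a : I, inner ℂ (η : H) (π a u) = g₀ a) :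
    ∃ T : idealOrbitClosure π u I →L[ℂ] idealOrbitClosure π u I,
      (∀ a : I, (T (idealOrbitMapClosure π u I a) : H) = π a η) ∧
      (∀ m n, inner ℂ (T m) n = inner ℂ m (T n)) ∧
      ∀ x m, (T (idealOrbitRestrict π u I x m) : H) = π x (T m) := by
  have hdense := denseRange_idealOrbitMapClosure π u I
  have hinner (a b : I) : inner ℂ (π a η) (π b u) =
      g₀ ⟨star (a : A) * b, I.mul_mem_left _ b.2⟩ := by
    rw [← hη, map_mul, mul_apply_eq_comp, ← StarAlgHom.inner_map_star_apply _ (star _),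
      star_star]
  let f : I →ₗ[ℂ] idealOrbitClosure π u I :=
    { toFun a := idealOrbitRestrict π u I a η
      map_add' a b := Subtype.ext (by simp)
      map_smul' c a := Subtype.ext (by simp) }
  have hf (a : I) : (f a : H) = π a η := rfl
  have hbound (a : I) : ‖f a‖ ≤ C * ‖idealOrbitMapClosure π u I a‖ := by
    -- The norm of `f a` is found by pairing with the dense vectors `π b u`, then taking `m = f a`.
    have key (m : idealOrbitClosure π u I) :
        ‖inner ℂ (f a) m‖ ≤ C * ‖idealOrbitMapClosure π u I a‖ * ‖m‖ := by
      refine hdense.induction_on (p := fun m ↦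
        ‖inner ℂ (f a) m‖ ≤ C * ‖idealOrbitMapClosure π u I a‖ * ‖m‖) m
        (isClosed_le (by fun_prop) (by fun_prop)) fun b ↦ ?_
      rw [Submodule.coe_inner, hf, coe_idealOrbitMapClosure, hinner]
      exact hC a b
    have h := key (f a)
    rw [inner_self_eq_norm_sq_to_K] at h
    -- `C` may be negative, so if `f a = 0` the sign of the right side must come from `hC a a`.
    by_cases h0 : ‖f a‖ = 0
    · have h2 := hC a a
      rw [← hinner, ← hf, norm_eq_zero.mp h0] at h2
      by_cases h3 : ‖π a u‖ = 0
      · rw [h0]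
        change 0 ≤ C * ‖π a u‖
        simp [h3]
      · have h4 : 0 < ‖π a u‖ := lt_of_le_of_ne (norm_nonneg _) (Ne.symm h3)
        rw [h0]
        change 0 ≤ C * ‖π a u‖
        simp only [ZeroMemClass.coe_zero, inner_zero_left, norm_zero] at h2
        exact nonneg_of_mul_nonneg_left h2 h4
    · have h1 : 0 < ‖f a‖ := lt_of_le_of_ne (norm_nonneg _) (Ne.symm h0)
      refine le_of_mul_le_mul_right ?_ h1
      simpa [sq] using h
  let T := f.extendOfNorm (idealOrbitMapClosure π u I)
  have hT (a : I) : T (idealOrbitMapClosure π u I a) = f a :=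
    LinearMap.extendOfNorm_eq hdense ⟨C, hbound⟩ a
  refine ⟨T, fun a ↦ by rw [hT, hf], fun m n ↦ ?_, fun x m ↦ ?_⟩
  · refine hdense.induction_on₂ (p := fun m n ↦ inner ℂ (T m) n = inner ℂ m (T n))
      (isClosed_eq (by fun_prop) (by fun_prop)) (fun a b ↦ ?_) m n
    rw [hT, hT, Submodule.coe_inner, Submodule.coe_inner, hf, hf, coe_idealOrbitMapClosure,
      coe_idealOrbitMapClosure, hinner, ← inner_conj_symm, hinner, hs]
    simp
  · refine hdense.induction_on (p := fun m ↦ (T (idealOrbitRestrict π u I x m) : H) = π x (T m)) m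
      (isClosed_eq (by fun_prop) (by fun_prop)) fun a ↦ ?_
    have : idealOrbitRestrict π u I x (idealOrbitMapClosure π u I a) =
        idealOrbitMapClosure π u I ⟨x * a, I.mul_mem_left _ a.2⟩ := Subtype.ext (by simp)
    rw [this, hT, hT, hf, hf]
    simp

/-- A symmetric functional on a left ideal which is bounded with respect to a vector of a
representation has a continuous hermitian extension. -/
theorem exists_hermitian_extension_of_representation (π : A →⋆ₐ[ℂ] (H →L[ℂ] H)) (u : H)
    {I : Ideal A} {g₀ : I →ₗ[ℂ] ℂ} (hs : IsSymmetricFunctional g₀) {C : ℝ}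
    (hC : ∀ (x : A) (a : I), ‖g₀ ⟨star x * (a : A), I.mul_mem_left _ a.2⟩‖ ≤
      C * ‖π x u‖ * ‖π a u‖) :
    ∃ g : A →L[ℂ] ℂ, IsHermitianFunctional (g : A →ₗ[ℂ] ℂ) ∧ ∀ a : I, g (a : A) = g₀ a := by
  obtain ⟨η, hη⟩ := exists_inner_eq_of_le_norm π u g₀ (C := C * ‖u‖)
    fun a ↦ by simpa using hC 1 a
  obtain ⟨T, hT, hsymm, hcomm⟩ := exists_isSymmetric_commute π u hs (fun a b ↦ hC a b) η hη
  let M := idealOrbitClosure π u I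
  let e : M := M.orthogonalProjectionOnto u
  have he (m : M) : inner ℂ (m : H) (e : H) = inner ℂ (m : H) u := by
    rw [← Submodule.coe_inner, Submodule.inner_orthogonalProjectionOnto_eq_of_mem_left]
  have he' (m : M) : inner ℂ (e : H) (m : H) = inner ℂ u (m : H) := by
    rw [← inner_conj_symm, he, inner_conj_symm]
  refine ⟨vectorFunctional π η u + vectorFunctional π u η - vectorFunctional π (T e) e,
    fun x ↦ ?_, fun a ↦ ?_⟩
  · have h (v w : H) : inner ℂ v (π (star x) w) = star (inner ℂ w (π x v)) := by
      rw [← StarAlgHom.inner_map_star_apply, star_star, ← inner_conj_symm]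
      rfl
    have h' : inner ℂ (e : H) (π x (T e)) = inner ℂ (T e : H) (π x e) := by
      rw [← hcomm, ← Submodule.coe_inner, ← hsymm]
      rfl
    simp only [ContinuousLinearMap.coe_coe, sub_apply, add_apply, vectorFunctional_apply, h, h',
      star_sub, star_add]
    rw [add_comm (star (inner ℂ u _))]
  · have h₁ : inner ℂ (T e : H) (π a e) = inner ℂ (T e : H) (π a u) := by
      rw [← StarAlgHom.inner_map_star_apply, ← StarAlgHom.inner_map_star_apply]
      exact he (idealOrbitRestrict π u I (star a) (T e))
    -- `π a η = T (π a u)` lies in `M`, so `u` may be replaced by `e` and `T` moved across.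
    have h₂ : inner ℂ u (π a η) = inner ℂ (T e : H) (π a u) := by
      rw [← hT, ← he', ← Submodule.coe_inner, ← hsymm]
      rfl
    simp [h₁, h₂, hη]

end Representation

/-! ### Positive functionals and decomposition of hermitian ones -/

section Positive

variable {A : Type*} [CStarAlgebra A]

lemma IsPositiveFunctional.nonneg [PartialOrder A] [StarOrderedRing A] {f : A →ₗ[ℂ] ℂ}
    (hf : IsPositiveFunctional f) (x : A) (hx : 0 ≤ x) : 0 ≤ f x := by
  obtain ⟨y, rfl⟩ := CStarAlgebra.nonneg_iff_eq_star_mul_self.mp hx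
  exact hf y

/-- Every positive functional on a C⋆-algebra is a positive linear map. -/
lemma IsPositiveFunctional.exists_positiveLinearMap [PartialOrder A] [StarOrderedRing A]
    {f : A →ₗ[ℂ] ℂ} (hf : IsPositiveFunctional f) : ∃ F : A →ₚ[ℂ] ℂ, ∀ x, F x = f x :=
  ⟨PositiveLinearMap.mk₀ f hf.nonneg, fun _ ↦ rfl⟩

/-- The Cauchy–Schwarz inequality for positive functionals. -/
lemma IsPositiveFunctional.norm_apply_star_mul_le {f : A →ₗ[ℂ] ℂ} (hf : IsPositiveFunctional f)
    (x y : A) : ‖f (star x * y)‖ ≤ √(f (star x * x)).re * √(f (star y * y)).re := by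
  let _ := CStarAlgebra.spectralOrder A
  let _ := CStarAlgebra.spectralOrderedRing A
  obtain ⟨F, hF⟩ := hf.exists_positiveLinearMap
  simpa only [PositiveLinearMap.preGNS_inner_def, PositiveLinearMap.preGNS_norm_def, hF,
    PositiveLinearMap.ofPreGNS_toPreGNS] using
      norm_inner_le_norm (𝕜 := ℂ) (F.toPreGNS x) (F.toPreGNS y)

open ComplexStarModule in
/-- A real functional on the self-adjoint part extends to a complex functional. -/
lemma exists_complex_extension (f : selfAdjoint A →ₗ[ℝ] ℝ) :
    ∃ F : A →ₗ[ℂ] ℂ, ∀ a : selfAdjoint A, F a = f a := by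
  refine ⟨Module.Dual.extendRCLike (f ∘ₗ realPart), fun a ↦ ?_⟩
  simp [Module.Dual.extendRCLike_apply, realPart_I_smul]

/-- Bounds by multiples of the unit on a self-adjoint element bound its norm. -/
lemma IsSelfAdjoint.norm_le_of_neg_algebraMap_le [PartialOrder A] [StarOrderedRing A]
    [Nontrivial A] {a : A} (ha : IsSelfAdjoint a) {t : ℝ} (h₁ : -algebraMap ℝ A t ≤ a)
    (h₂ : a ≤ algebraMap ℝ A t) : ‖a‖ ≤ t := by
  rw [← map_neg, algebraMap_le_iff_le_spectrum] at h₁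
  rw [le_algebraMap_iff_spectrum_le] at h₂
  rcases CStarAlgebra.norm_or_neg_norm_mem_spectrum (a := a) with h | h
  · exact h₂ _ h
  · exact neg_le_neg_iff.mp (h₁ _ h)

/-- A continuous hermitian functional is the difference of two positive functionals. -/
theorem exists_isPositiveFunctional_sub (g : A →L[ℂ] ℂ)
    (hg : IsHermitianFunctional (g : A →ₗ[ℂ] ℂ)) :
    ∃ f : A →ₗ[ℂ] ℂ, IsPositiveFunctional f ∧ IsPositiveFunctional (f - (g : A →ₗ[ℂ] ℂ)) := by
  let _ := CStarAlgebra.spectralOrder A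
  let _ := CStarAlgebra.spectralOrderedRing A
  let r : selfAdjoint A →ₗ[ℝ] ℝ :=
    Complex.reLm ∘ₗ (g : A →ₗ[ℂ] ℂ).restrictScalars ℝ ∘ₗ (selfAdjoint.submodule ℝ A).subtype
  have hr (a : selfAdjoint A) : g a = r a := by
    have := hg a
    rw [selfAdjoint.star_val_eq] at this
    exact (Complex.conj_eq_iff_re.mp this.symm).symm
  -- The sought functional is `Φ (a, u, t) = f a + r u + ‖g‖ t`, nonnegative where both components
  -- of `L` are. For `b ≥ 0`, the points `(b, 0, 0)` and `(b, -b, 0)` give `f b ≥ 0` and `f b ≥ r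
  -- b`. On `a = 0` the cone says `-t ≤ u ≤ t`, so `‖u‖ ≤ t` and `r u ≥ -‖g‖ t`.
  let L : selfAdjoint A × selfAdjoint A × ℝ →ₗ[ℝ] A × A :=
    { toFun p := ((p.1 : A) + p.2.1 + algebraMap ℝ A p.2.2, algebraMap ℝ A p.2.2 - p.2.1)
      map_add' := by
        rintro ⟨a, u, t⟩ ⟨b, v, w⟩
        ext <;> simp <;> abel
      map_smul' := by
        rintro c ⟨a, u, t⟩
        ext <;> simp [Algebra.algebraMap_eq_smul_one, smul_add, smul_sub, mul_smul] }
  let s : PointedCone ℝ (selfAdjoint A × selfAdjoint A × ℝ) :=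
    (PointedCone.positive ℝ (A × A)).comap L
  have hs (a u : selfAdjoint A) (t : ℝ) : (a, u, t) ∈ s ↔
      0 ≤ (a : A) + u + algebraMap ℝ A t ∧ 0 ≤ algebraMap ℝ A t - (u : A) := by
    change 0 ≤ L _ ↔ _
    rfl
  let N : selfAdjoint A × selfAdjoint A × ℝ →ₗ[ℝ] ℝ :=
    r ∘ₗ LinearMap.fst ℝ _ _ ∘ₗ LinearMap.snd ℝ _ _ +
    ‖g‖ • (LinearMap.snd ℝ _ _ ∘ₗ LinearMap.snd ℝ _ _)
  let D : Submodule ℝ (selfAdjoint A × selfAdjoint A × ℝ) :=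
    LinearMap.ker (LinearMap.fst ℝ (selfAdjoint A) (selfAdjoint A × ℝ))
  obtain ⟨Φ, hΦ, hΦs⟩ := riesz_extension s ⟨D, N.domRestrict D⟩ (by
    rintro ⟨⟨a, u, t⟩, ha⟩ hp
    obtain rfl : a = 0 := ha
    obtain ⟨h₁, h₂⟩ := (hs _ _ _).mp hp
    change 0 ≤ r u + ‖g‖ * t
    rw [ZeroMemClass.coe_zero, zero_add, ← neg_le_iff_add_nonneg] at h₁
    rw [sub_nonneg] at h₂
    have hru : -(‖g‖ * ‖(u : A)‖) ≤ r u :=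
      (neg_le_neg (g.le_opNorm u)).trans (neg_le_of_abs_le (Complex.abs_re_le_norm (g u)))
    -- In the zero algebra the cone does not constrain `t`, but `‖g‖ = 0`.
    rcases subsingleton_or_nontrivial A with _ | _
    · have hg0 : g = 0 := Subsingleton.elim _ _
      rw [hg0] at hru ⊢
      simpa using hru
    · have := mul_le_mul_of_nonneg_left
        (u.2.norm_le_of_neg_algebraMap_le h₁ h₂) (norm_nonneg g)
      linarith) (by
    rintro ⟨a, u, t⟩
    -- Chosen so that the sum is `(a, 0, ‖a‖)`, in the cone since `-‖a‖ ≤ a`.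
    refine ⟨⟨(0, -u, ‖(a : A)‖ - t), rfl⟩, ?_⟩
    have := a.2.neg_algebraMap_norm_le_self
    rw [neg_le_iff_add_nonneg] at this
    change ((0 + a, -u + u, ‖(a : A)‖ - t + t) : selfAdjoint A × selfAdjoint A × ℝ) ∈ s
    rw [zero_add, neg_add_cancel, sub_add_cancel, hs]
    refine ⟨by simpa using this, ?_⟩
    rw [ZeroMemClass.coe_zero, sub_zero]
    exact algebraMap_nonneg A (norm_nonneg _))
  obtain ⟨f, hf⟩ := exists_complex_extension (Φ ∘ₗ LinearMap.inl ℝ (selfAdjoint A) _)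
  refine ⟨f, fun x ↦ ?_, fun x ↦ ?_⟩
  all_goals
    let b : selfAdjoint A := ⟨star x * x, IsSelfAdjoint.star_mul_self x⟩
    have hb : 0 ≤ (b : A) := star_mul_self_nonneg x
  · change 0 ≤ f b
    rw [hf, Complex.zero_le_real]
    exact hΦs _ ((hs _ _ _).mpr (by simpa using hb))
  · change 0 ≤ f b - g b
    have h₁ : 0 ≤ Φ (b, -b, 0) := hΦs _ ((hs _ _ _).mpr (by simpa using hb))
    have h₂ : Φ (0, -b, 0) = -r b := by
      have := hΦ ⟨(0, -b, 0), rfl⟩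
      rw [this]
      change r (-b) + ‖g‖ * 0 = _
      simp
    have h₃ : ((b, -b, 0) : selfAdjoint A × selfAdjoint A × ℝ) = (b, 0) + (0, -b, 0) := by simp
    rw [h₃, map_add, h₂] at h₁
    rw [hf, hr, ← Complex.ofReal_sub, Complex.zero_le_real, sub_eq_add_neg]
    exact h₁

lemma IsPositiveFunctional.add {f g : A →ₗ[ℂ] ℂ} (hf : IsPositiveFunctional f)
    (hg : IsPositiveFunctional g) : IsPositiveFunctional (f + g) :=
  fun x ↦ add_nonneg (hf x) (hg x)

/-- A continuous hermitian functional satisfies a Cauchy–Schwarz inequality with respect to some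
positive functional. -/
theorem exists_isPositiveFunctional_bound (g : A →L[ℂ] ℂ)
    (hg : IsHermitianFunctional (g : A →ₗ[ℂ] ℂ)) :
    ∃ f : A →ₗ[ℂ] ℂ, IsPositiveFunctional f ∧ ∀ x y : A,
      ‖g (star x * y)‖ ^ 2 ≤ 2 ^ 2 * (f (star x * x)).re * (f (star y * y)).re := by
  obtain ⟨f, hf, hfg⟩ := exists_isPositiveFunctional_sub g hg
  have hadd := hf.add hfg
  refine ⟨_, hadd, fun x y ↦ ?_⟩
  set F := f + (f - (g : A →ₗ[ℂ] ℂ)) with hF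
  have hle (z : A) : √(f (star z * z)).re ≤ √(F (star z * z)).re ∧
      √((f - (g : A →ₗ[ℂ] ℂ)) (star z * z)).re ≤ √(F (star z * z)).re := by
    have h₁ := (Complex.le_def.mp (hf z)).1
    have h₂ := (Complex.le_def.mp (hfg z)).1
    rw [Complex.zero_re] at h₁ h₂
    rw [hF, LinearMap.add_apply, Complex.add_re]
    exact ⟨Real.sqrt_le_sqrt (by linarith), Real.sqrt_le_sqrt (by linarith)⟩
  have hbound : ‖g (star x * y)‖ ≤ 2 * (√(F (star x * x)).re * √(F (star y * y)).re) := by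
    calc ‖g (star x * y)‖
        = ‖f (star x * y) - (f - (g : A →ₗ[ℂ] ℂ)) (star x * y)‖ := by simp
      _ ≤ ‖f (star x * y)‖ + ‖(f - (g : A →ₗ[ℂ] ℂ)) (star x * y)‖ := norm_sub_le _ _
      _ ≤ √(F (star x * x)).re * √(F (star y * y)).re +
          √(F (star x * x)).re * √(F (star y * y)).re := by
        gcongr
        · exact (hf.norm_apply_star_mul_le x y).trans 
            (mul_le_mul (hle x).1 (hle y).1 (Real.sqrt_nonneg _) (Real.sqrt_nonneg _))
        · exact (hfg.norm_apply_star_mul_le x y).trans 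
            (mul_le_mul (hle x).2 (hle y).2 (Real.sqrt_nonneg _) (Real.sqrt_nonneg _))
      _ = _ := by ring
  calc ‖g (star x * y)‖ ^ 2
      ≤ (2 * (√(F (star x * x)).re * √(F (star y * y)).re)) ^ 2 := by gcongr
    _ = _ := by
      rw [mul_pow, mul_pow, Real.sq_sqrt (Complex.le_def.mp (hadd x)).1,
        Real.sq_sqrt (Complex.le_def.mp (hadd y)).1, mul_assoc]

/-- A symmetric functional on a left ideal which is bounded with respect to a positive functional
has a continuous hermitian extension. -/
theorem exists_hermitian_extension {I : Ideal A} {g₀ : I →ₗ[ℂ] ℂ} (hs : IsSymmetricFunctional g₀)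
    {f : A →ₗ[ℂ] ℂ} (hf : IsPositiveFunctional f) (hb : IsBoundedByFunctional f g₀) :
    ∃ g : A →L[ℂ] ℂ, IsHermitianFunctional (g : A →ₗ[ℂ] ℂ) ∧ ∀ a : I, g (a : A) = g₀ a := by
  let _ := CStarAlgebra.spectralOrder A
  let _ := CStarAlgebra.spectralOrderedRing A
  obtain ⟨F, hF⟩ := hf.exists_positiveLinearMap
  obtain ⟨α, hα, h⟩ := hb
  have hnorm (x : A) : ‖F.gnsStarAlgHom x (F.toPreGNS 1 : F.GNS)‖ = √(f (star x * x)).re := by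
    change ‖F.gnsNonUnitalStarAlgHom x (F.toPreGNS 1 : F.GNS)‖ = _
    rw [PositiveLinearMap.gnsNonUnitalStarAlgHom_apply_coe, UniformSpace.Completion.norm_coe,
      PositiveLinearMap.preGNS_norm_def]
    simp [hF]
  refine exists_hermitian_extension_of_representation F.gnsStarAlgHom (F.toPreGNS 1 : F.GNS) hs
    (C := α) fun x a ↦ ?_
  rw [hnorm, hnorm]
  refine le_of_sq_le_sq ?_ (by positivity)
  rw [mul_pow, mul_pow, Real.sq_sqrt (Complex.le_def.mp (hf x)).1,
    Real.sq_sqrt (Complex.le_def.mp (hf a)).1]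
  exact h x a

end Positive

theorem corollary4p2 {A : Type*} [CStarAlgebra A] (I : Ideal A) (g₀ : I →ₗ[ℂ] ℂ) :
    (∃ g : A →L[ℂ] ℂ, IsHermitianFunctional (g : A →ₗ[ℂ] ℂ) ∧ ∀ a : I, g (a : A) = g₀ a) ↔
      (IsSymmetricFunctional g₀ ∧
        ∃ f : A →ₗ[ℂ] ℂ, IsPositiveFunctional f ∧ IsBoundedByFunctional f g₀) := by
  constructor
  · rintro ⟨g, hg, hext⟩
    obtain ⟨f, hf, hb⟩ := exists_isPositiveFunctional_bound g hg
    refine ⟨fun a b ↦ ?_, f, hf, 2, two_pos, fun x a ↦ ?_⟩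
    · rw [← hext, ← hext]
      simpa using hg (star (a : A) * b)
    · rw [← hext]
      exact hb x a
  · rintro ⟨hs, f, hf, hb⟩
    exact exists_hermitian_extension hs hf hb
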